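/- Let $\Gamma$ be an infinite set, let $\ell_\infty(\Gamma)$ be the Banach space of bounded complex-valued functions on $\Gamma$ with the supremum norm, let $X$ be a complex Banach space, and let $\Delta : S(\ell_\infty(\Gamma)) \to S(X)$ be a surjective isometry between the unit spheres. For $n \in \Gamma$ let $e_n \in \ell_\infty(\Gamma)$ be the function with $e_n(n)=1$ and $e_n(m)=0$ for $m \neq n$. Define $\sigma_n : \mathbb{C} \to \mathbb{C}$ by $\sigma_n(\alpha) = \alpha$ if $\Delta(\lambda e_n) = \lambda \Delta(e_n)$ for some $\lambda \in \mathbb{C}\setminus\mathbb{R}$ with $|\lambda| = 1$, and by $\sigma_n(\alpha) = \overline{\alpha}$ otherwise. For $\alpha \in \mathbb{C}$ and $a \in \ell_\infty(\Gamma)$ let $\alpha \odot a \in \ell_\infty(\Gamma)$ be given by $(\alpha \odot a)(n) = \sigma_n(\alpha)\, a(n)$ for $n\in\Gamma$. Let $k \geq 1$ and let $v_1, \ldots, v_k \in \ell_\infty(\Gamma)$ be non-zero partial isometries (that is, each $v_j v_j^*$ is a projection; equivalently, $|v_j(n)| \in \{0,1\}$ for all $n \in \Gamma$) that are mutually orthogonal,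 that is, $v_i v_j = 0$ for $i \neq j$. Then $\{\Delta(v_1), \ldots, \Delta(v_k)\}$ is completely $M$-orthogonal, that is, $$\Big\| \sum_{j=1}^k \alpha_j \Delta(v_j) \Big\| = \max_{1 \leq j \leq k} \| \alpha_j \Delta(v_j) \| \quad \text{for all } \alpha_1, \ldots, \alpha_k \in \mathbb{C}.$$ Moreover, for all $\alpha_1, \ldots, \alpha_k \in \mathbb{C}\setminus\{0\}$ with $\max_j |\alpha_j| = 1$, the element $\sum_{j=1}^k \alpha_j \odot v_j$ has norm one and $$\sum_{j=1}^k \alpha_j \Delta(v_j) = \Delta\Big( \sum_{j=1}^k \alpha_j \odot v_j \Big).$$ -/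

import Mathlib

open scoped ENNReal ComplexConjugate

/-- The complex Banach space `ℓ_∞(Γ)` of bounded complex-valued functions on `Γ` (sup norm). -/
abbrev EllInfty (Γ : Type*) : Type _ := lp (fun _ : Γ => ℂ) ∞

/-- The unit sphere `S(E)` of a normed space. -/
abbrev UnitSphere (E : Type*) [NormedAddCommGroup E] : Type _ := Metric.sphere (0 : E) 1

/-- `v` is a partial isometry when `v v*` is a projection (a self-adjoint idempotent). -/
def IsPartialIsometry {Γ : Type*} (v : EllInfty Γ) : Prop :=
  IsStarProjection (v * star v)

/-- The pointwise description: `|v(k)| (1 - |v(k)|) = 0` for all `k`. -/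
theorem isPartialIsometry_iff {Γ : Type*} (v : EllInfty Γ) :
    IsPartialIsometry v ↔ ∀ k, ‖v k‖ * (1 - ‖v k‖) = 0 := by
  have key : ∀ k, (v * star v) k = ((‖v k‖ ^ 2 : ℝ) : ℂ) := fun k => by
    have h : (v * star v) k = v k * conj (v k) := rfl
    rw [h, Complex.mul_conj, Complex.normSq_eq_norm_sq]
  constructor
  · intro h k
    have h2 : (v * star v) k * (v * star v) k = (v * star v) k :=
      congrArg (fun f : EllInfty Γ => f k) h.isIdempotentElem
    rw [key, ← Complex.ofReal_mul, Complex.ofReal_inj] at h2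
    have h4 : ‖v k‖ ^ 2 * (1 + ‖v k‖) * (1 - ‖v k‖) = 0 := by linear_combination -h2
    have h5 : (1 + ‖v k‖) ≠ 0 := by positivity
    rcases mul_eq_zero.1 h4 with h6 | h6
    · rcases mul_eq_zero.1 h6 with h7 | h7
      · rw [pow_eq_zero_iff (by norm_num)] at h7
        simp [h7]
      · exact absurd h7 h5
    · simp [h6]
  · intro h
    refine ⟨?_, IsSelfAdjoint.mul_star_self v⟩
    refine lp.ext (funext fun k => ?_)
    change (v * star v) k * (v * star v) k = (v * star v) k
    rw [key, ← Complex.ofReal_mul, Complex.ofReal_inj]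
    linear_combination (-‖v k‖ * (1 + ‖v k‖)) * h k

/-- A non-zero partial isometry has norm one. -/
theorem IsPartialIsometry.mem_sphere {Γ : Type*} {v : EllInfty Γ}
    (hv : IsPartialIsometry v) (h0 : v ≠ 0) : v ∈ Metric.sphere (0 : EllInfty Γ) 1 := by
  rw [mem_sphere_zero_iff_norm]
  have h := (isPartialIsometry_iff v).1 hv
  have h' : ∀ k, ‖v k‖ = 0 ∨ ‖v k‖ = 1 := fun k => by
    rcases mul_eq_zero.1 (h k) with h1 | h1
    · exact Or.inl h1
    · exact Or.inr (by linarith)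
  apply le_antisymm
  · refine lp.norm_le_of_forall_le zero_le_one fun k => ?_
    rcases h' k with h1 | h1 <;> simp [h1]
  · by_contra hlt
    apply h0
    refine lp.ext (funext fun k => ?_)
    rcases h' k with h1 | h1
    · simpa using h1
    · exact absurd (h1 ▸ lp.norm_apply_le_norm (by simp) v k) hlt

open Classical in
/-- The function `e_n`, equal to `1` at `n` and to `0` elsewhere. -/
noncomputable def basisVec {Γ : Type*} (n : Γ) : EllInfty Γ := lp.single ∞ n 1

theorem basisVec_apply_self {Γ : Type*} (n : Γ) : (basisVec n : EllInfty Γ) n = 1 := by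
  classical
  simp [basisVec]

theorem basisVec_apply_of_ne {Γ : Type*} {n m : Γ} (h : m ≠ n) :
    (basisVec n : EllInfty Γ) m = 0 := by
  classical
  simp [basisVec, h]

theorem norm_basisVec {Γ : Type*} (n : Γ) : ‖(basisVec n : EllInfty Γ)‖ = 1 := by
  classical
  rw [basisVec, lp.norm_single (by simp)]
  simp

/-- The element `λ e_n` of the unit sphere, for `|λ| = 1`. -/
noncomputable def circleBasisVec {Γ : Type*} (n : Γ) (c : Circle) : UnitSphere (EllInfty Γ) :=
  ⟨(c : ℂ) • basisVec n, by
    rw [mem_sphere_zero_iff_norm, norm_smul, norm_basisVec, mul_one]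
    exact Circle.norm_coe c⟩

open Classical in
/-- The map `σ_n : ℂ → ℂ` attached to `Δ`: it is the identity if `Δ(λ e_n) = λ Δ(e_n)` for some
non-real `λ` of modulus one, and complex conjugation otherwise. -/
noncomputable def sigma {Γ X : Type*} [NormedAddCommGroup X] [NormedSpace ℂ X]
    (Δ : UnitSphere (EllInfty Γ) → UnitSphere X) (n : Γ) (α : ℂ) : ℂ :=
  if ∃ c : Circle, (c : ℂ).im ≠ 0 ∧
      (Δ (circleBasisVec n c) : X) = (c : ℂ) • (Δ (circleBasisVec n 1) : X)
  then α else conj α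

theorem norm_sigma {Γ X : Type*} [NormedAddCommGroup X] [NormedSpace ℂ X]
    (Δ : UnitSphere (EllInfty Γ) → UnitSphere X) (n : Γ) (α : ℂ) : ‖sigma Δ n α‖ = ‖α‖ := by
  unfold sigma
  split_ifs
  · rfl
  · exact Complex.norm_conj α

/-- The twisted scalar product `(α ⊙ a)(k) = σ_k(α) a(k)`. -/
noncomputable def twistedSMul {Γ X : Type*} [NormedAddCommGroup X] [NormedSpace ℂ X]
    (Δ : UnitSphere (EllInfty Γ) → UnitSphere X) (α : ℂ) (a : EllInfty Γ) : EllInfty Γ :=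
  ⟨fun k => sigma Δ k α * a k, memℓp_infty ⟨‖α‖ * ‖a‖, by
    rintro _ ⟨k, rfl⟩
    change ‖sigma Δ k α * a k‖ ≤ _
    rw [norm_mul, norm_sigma]
    exact mul_le_mul_of_nonneg_left (lp.norm_apply_le_norm (by simp) a k) (norm_nonneg α)⟩⟩

/-- Complete `M`-orthogonality of `x_1, …, x_k` (meant for `k ≥ 1`): for all complex scalars
`α_j`, the norm of `∑ α_j x_j` is the maximum of the norms `‖α_j x_j‖`. -/
def CompletelyMOrthogonal {X : Type*} [NormedAddCommGroup X] [NormedSpace ℂ X] {k : ℕ}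
    (x : Fin k → X) : Prop :=
  ∀ α : Fin k → ℂ, IsGreatest (Set.range fun j => ‖α j • x j‖) ‖∑ j, α j • x j‖

/-! ### Metric geometry of the unit sphere of `EllInfty Γ`. -/

section Coordinates

variable {Γ : Type*}

/-! Everything rests on coordinate functionals: for each n a contractive linear ψ_n on X with ψ_n(Δ
x) = σ_n(x(n)) on the whole sphere (`exists_coordinate_functional`). As Δ is onto, they determine
the norm of X (`norm_le_of_coordinate_functionals`). At each n at most one v_j is non-zero, and then
it is unimodular, so both claims become one-term computations with the multiplicative involution
σ_n.

To build ψ_n, unimodular multiples of basis vectors are recognised from the metric alone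
(`exists_eq_circleBasisVec`). Hence γ Δ(e_n) is again the image of such a vector, in fact of some g
e_n with the same n; the map γ ↦ g preserves distances and fixes 1, so it is the identity or
conjugation, and σ_n records which (`circle_smul_basis`). In particular Δ(-e_n) = -Δ(e_n), which
makes the image of the face x(n) = 1 convex (`convex_imageFace`). Hahn–Banach gives a functional
equal to 1 there. Rotation settles |x(n)| = 1, and distances to such points settle every other x. -/

theorem EllInfty.ext {x y : EllInfty Γ} (h : ∀ n, x n = y n) : x = y :=
  lp.ext (funext h)

theorem EllInfty.norm_apply_le (x : EllInfty Γ) (n : Γ) : ‖x n‖ ≤ ‖x‖ :=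
  lp.norm_apply_le_norm (by simp) x n

theorem EllInfty.norm_apply_le_one (x : UnitSphere (EllInfty Γ)) (n : Γ) :
    ‖(x : EllInfty Γ) n‖ ≤ 1 :=
  (EllInfty.norm_apply_le _ n).trans_eq (mem_sphere_zero_iff_norm.1 x.2)

theorem EllInfty.norm_eq_one {x : EllInfty Γ} (h : ∀ k, ‖x k‖ ≤ 1) {n : Γ} (hn : ‖x n‖ = 1) :
    ‖x‖ = 1 :=
  le_antisymm (lp.norm_le_of_forall_le zero_le_one h) (hn ▸ EllInfty.norm_apply_le x n)

theorem EllInfty.dist_apply_le (x y : UnitSphere (EllInfty Γ)) (n : Γ) :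
    ‖(x : EllInfty Γ) n - (y : EllInfty Γ) n‖ ≤ dist x y := by
  rw [Subtype.dist_eq, dist_eq_norm]
  exact EllInfty.norm_apply_le ((x : EllInfty Γ) - (y : EllInfty Γ)) n

theorem EllInfty.dist_le {x y : UnitSphere (EllInfty Γ)} {r : ℝ} (hr : 0 ≤ r)
    (h : ∀ n, ‖(x : EllInfty Γ) n - (y : EllInfty Γ) n‖ ≤ r) : dist x y ≤ r := by
  rw [Subtype.dist_eq, dist_eq_norm]
  exact lp.norm_le_of_forall_le hr h

theorem circleBasisVec_apply_self (n : Γ) (c : Circle) :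
    (circleBasisVec n c : EllInfty Γ) n = c := by
  change (c : ℂ) * (basisVec n : EllInfty Γ) n = c
  rw [basisVec_apply_self, mul_one]

theorem circleBasisVec_apply_of_ne {n m : Γ} (h : m ≠ n) (c : Circle) :
    (circleBasisVec n c : EllInfty Γ) m = 0 := by
  change (c : ℂ) * (basisVec n : EllInfty Γ) m = 0
  rw [basisVec_apply_of_ne h, mul_zero]

theorem dist_circleBasisVec_self (n : Γ) (c d : Circle) :
    dist (circleBasisVec n c) (circleBasisVec n d) = ‖(c : ℂ) - d‖ := by
  apply le_antisymm
  · refine EllInfty.dist_le (norm_nonneg _) fun m => ?_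
    by_cases h : m = n
    · subst h
      simp only [circleBasisVec_apply_self, le_refl]
    · simp [circleBasisVec_apply_of_ne h]
  · simpa only [circleBasisVec_apply_self] using
      EllInfty.dist_apply_le (circleBasisVec n c) (circleBasisVec n d) n

theorem dist_circleBasisVec_of_ne {n m : Γ} (h : n ≠ m) (c d : Circle) :
    dist (circleBasisVec n c) (circleBasisVec m d) = 1 := by
  apply le_antisymm
  · refine EllInfty.dist_le zero_le_one fun k => ?_
    by_cases hk : k = n
    · subst hk
      simp [circleBasisVec_apply_self, circleBasisVec_apply_of_ne h, Circle.norm_coe]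
    · rw [circleBasisVec_apply_of_ne hk, zero_sub, norm_neg]
      exact EllInfty.norm_apply_le_one _ k
  · simpa [circleBasisVec_apply_self, circleBasisVec_apply_of_ne h, Circle.norm_coe] using
      EllInfty.dist_apply_le (circleBasisVec n c) (circleBasisVec m d) n

/-- Strict convexity of the disc, through the parallelogram law. -/
theorem Complex.eq_neg_of_two_le_norm_sub {z w : ℂ} (hz : ‖z‖ ≤ 1) (hw : ‖w‖ ≤ 1)
    (h : 2 ≤ ‖z - w‖) : z = -w := by
  have h1 := parallelogram_law_with_norm ℂ z w
  have h2 : ‖z + w‖ ^ 2 ≤ 0 := by nlinarith [norm_nonneg z, norm_nonneg w]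
  have h3 : z + w = 0 := norm_eq_zero.1 (pow_eq_zero_iff (two_ne_zero) |>.1
    (le_antisymm h2 (sq_nonneg _)))
  exact eq_neg_of_add_eq_zero_left h3

/-- The points antipodal to a unimodular multiple of `e_n` form a face determined by the
`n`-th coordinate. -/
theorem dist_circleBasisVec_eq_two_iff (y : UnitSphere (EllInfty Γ)) (n : Γ) (c : Circle) :
    dist y (circleBasisVec n c) = 2 ↔ (y : EllInfty Γ) n = -c := by
  constructor
  · intro h
    apply Complex.eq_neg_of_two_le_norm_sub (EllInfty.norm_apply_le_one y n)
      (Circle.norm_coe c).le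
    by_contra! hlt
    have : dist y (circleBasisVec n c) ≤ max 1 ‖(y : EllInfty Γ) n - c‖ := by
      refine EllInfty.dist_le (zero_le_one.trans (le_max_left _ _)) fun k => ?_
      by_cases hk : k = n
      · subst hk
        rw [circleBasisVec_apply_self]
        exact le_max_right _ _
      · rw [circleBasisVec_apply_of_ne hk, sub_zero]
        exact (EllInfty.norm_apply_le_one y k).trans (le_max_left _ _)
    rw [h] at this
    exact absurd this (not_le.2 (max_lt one_lt_two hlt))
  · intro h
    apply le_antisymm
    · refine EllInfty.dist_le zero_le_two fun k => (norm_sub_le _ _).trans ?_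
      linarith [EllInfty.norm_apply_le_one y k,
        EllInfty.norm_apply_le_one (circleBasisVec n c) k]
    · have h1 := EllInfty.dist_apply_le y (circleBasisVec n c) n
      rw [circleBasisVec_apply_self, h, ← neg_add', norm_neg, ← two_mul, norm_mul,
        Circle.norm_coe] at h1
      simpa using h1

theorem dist_circleBasisVec_le_one {y : UnitSphere (EllInfty Γ)} {n : Γ} {c : Circle}
    (h : (y : EllInfty Γ) n = c) : dist y (circleBasisVec n c) ≤ 1 := by
  refine EllInfty.dist_le zero_le_one fun k => ?_
  by_cases hk : k = n
  · subst hk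
    simp [circleBasisVec_apply_self, h]
  · rw [circleBasisVec_apply_of_ne hk, sub_zero]
    exact EllInfty.norm_apply_le_one y k

theorem Complex.exists_circle_norm_neg_sub (z : ℂ) :
    ∃ c : Circle, ‖-(c : ℂ) - z‖ = 1 + ‖z‖ := by
  by_cases hz : z = 0
  · exact ⟨1, by simp [hz]⟩
  · have h0 : ‖z‖ ≠ 0 := norm_ne_zero_iff.2 hz
    have h0' : (‖z‖ : ℂ) ≠ 0 := by exact_mod_cast h0
    refine ⟨⟨z / ‖z‖, mem_sphere_zero_iff_norm.2 ?_⟩, ?_⟩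
    · rw [norm_div, Complex.norm_real, norm_norm, div_self h0]
    · change ‖-(z / ‖z‖) - z‖ = _
      have : -(z / ‖z‖) - z = (-((1 + ‖z‖) / ‖z‖ : ℝ) : ℂ) * z := by
        push_cast
        field_simp
        ring
      rw [this, norm_mul, norm_neg, Complex.norm_real, Real.norm_of_nonneg (by positivity),
        div_mul_cancel₀ _ h0]

theorem EllInfty.exists_sphere_of_circle [Nonempty Γ] (f : Γ → Circle) :
    ∃ y : UnitSphere (EllInfty Γ), ∀ k, (y : EllInfty Γ) k = f k := by
  let y : EllInfty Γ := ⟨fun k => (f k : ℂ), memℓp_infty ⟨1, by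
    rintro _ ⟨k, rfl⟩
    exact (Circle.norm_coe (f k)).le⟩⟩
  have hy : ∀ k, ‖y k‖ = 1 := fun k => Circle.norm_coe (f k)
  exact ⟨⟨y, mem_sphere_zero_iff_norm.2
    (EllInfty.norm_eq_one (fun k => (hy k).le) (hy (Classical.arbitrary Γ)))⟩, fun k => rfl⟩

/-- Metric characterization of the unimodular multiples of the basis vectors: they are the points
of the sphere within distance one from every point antipodal to a suitable `x'`. -/
theorem exists_eq_circleBasisVec {x x' : UnitSphere (EllInfty Γ)}
    (h : ∀ y : UnitSphere (EllInfty Γ), dist y x' = 2 → dist y x ≤ 1) :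
    ∃ (n : Γ) (c : Circle), x = circleBasisVec n c := by
  classical
  have gap : ∀ m, (x : EllInfty Γ) m ≠ 0 →
      ∃ r < (1 : ℝ), ∀ k, k ≠ m → ‖(x' : EllInfty Γ) k‖ ≤ r := by
    intro m hm
    have : Nonempty Γ := ⟨m⟩
    choose s hs using Complex.exists_circle_norm_neg_sub
    -- Point y away from x at m and away from x' elsewhere. Then y is farther than 1 from x, so the
    -- hypothesis keeps it closer than 2 to x', which bounds x' off m.
    obtain ⟨y, hy⟩ := EllInfty.exists_sphere_of_circle fun k =>
      -s (if k = m then (x : EllInfty Γ) k else (x' : EllInfty Γ) k)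
    have h1 : 1 < dist y x := by
      have := EllInfty.dist_apply_le y x m
      rw [hy, if_pos rfl, Circle.coe_neg, hs] at this
      linarith [norm_pos_iff.2 hm]
    have h2 : dist y x' ≤ 2 :=
      EllInfty.dist_le zero_le_two fun k => (norm_sub_le _ _).trans
        (by linarith [EllInfty.norm_apply_le_one y k, EllInfty.norm_apply_le_one x' k])
    have h3 : dist y x' < 2 := lt_of_le_of_ne h2 fun h4 => absurd (h y h4) (not_le.2 h1)
    refine ⟨dist y x' - 1, by linarith, fun k hk => ?_⟩
    have := EllInfty.dist_apply_le y x' k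
    rw [hy, if_neg hk, Circle.coe_neg, hs] at this
    linarith
  have hx : ‖(x : EllInfty Γ)‖ = 1 := mem_sphere_zero_iff_norm.1 x.2
  have hx' : ‖(x' : EllInfty Γ)‖ = 1 := mem_sphere_zero_iff_norm.1 x'.2
  obtain ⟨m, hm⟩ : ∃ m, (x : EllInfty Γ) m ≠ 0 := by
    by_contra! h0
    have : (x : EllInfty Γ) = 0 := EllInfty.ext h0
    simp [this] at hx
  have huniq : ∀ k, k ≠ m → (x : EllInfty Γ) k = 0 := by
    -- With two support points m and k, the bounds off m and off k together would give ‖x'‖ < 1.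
    intro k hk
    by_contra hk0
    obtain ⟨r, hr, hr'⟩ := gap m hm
    obtain ⟨t, ht, ht'⟩ := gap k hk0
    have : ‖(x' : EllInfty Γ)‖ ≤ max r t := by
      refine lp.norm_le_of_forall_le ((norm_nonneg _).trans ((hr' k hk).trans (le_max_left _ _)))
        fun j => ?_
      by_cases hj : j = m
      · exact (ht' j (hj ▸ hk.symm)).trans (le_max_right _ _)
      · exact (hr' j hj).trans (le_max_left _ _)
    exact absurd this (not_le.2 ((max_lt hr ht).trans_eq hx'.symm))
  have hnorm : ‖(x : EllInfty Γ) m‖ = 1 := by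
    refine le_antisymm (EllInfty.norm_apply_le_one x m) (hx.symm.le.trans ?_)
    refine lp.norm_le_of_forall_le (norm_nonneg _) fun k => ?_
    by_cases hk : k = m
    · rw [hk]
    · simp [huniq k hk]
  refine ⟨m, ⟨_, mem_sphere_zero_iff_norm.2 hnorm⟩, Subtype.ext (EllInfty.ext fun k => ?_)⟩
  by_cases hk : k = m
  · subst hk
    exact (circleBasisVec_apply_self k ⟨(x : EllInfty Γ) k, _⟩).symm
  · exact (huniq k hk).trans (circleBasisVec_apply_of_ne hk _).symm

/-- Changing the `n`-th coordinate of a point of the sphere to `c` moves it by `‖x n - c‖` at most. -/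
theorem EllInfty.exists_sphere_apply_eq (x : UnitSphere (EllInfty Γ)) (n : Γ) (c : Circle) :
    ∃ y : UnitSphere (EllInfty Γ), (y : EllInfty Γ) n = c ∧
      dist x y ≤ ‖(x : EllInfty Γ) n - c‖ := by
  let y : EllInfty Γ := (x : EllInfty Γ) + ((c : ℂ) - (x : EllInfty Γ) n) • basisVec n
  have hy : ∀ k, y k = (x : EllInfty Γ) k +
      ((c : ℂ) - (x : EllInfty Γ) n) * (basisVec n : EllInfty Γ) k := fun k => rfl
  have hyn : y n = c := by rw [hy, basisVec_apply_self]; ring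
  have hyk : ∀ k, k ≠ n → y k = (x : EllInfty Γ) k := fun k hk => by
    rw [hy, basisVec_apply_of_ne hk]; ring
  refine ⟨⟨y, mem_sphere_zero_iff_norm.2 (EllInfty.norm_eq_one (n := n) (fun k => ?_) ?_)⟩,
    hyn, EllInfty.dist_le (norm_nonneg _) fun k => ?_⟩
  · by_cases hk : k = n
    · rw [hk, hyn, Circle.norm_coe]
    · rw [hyk k hk]
      exact EllInfty.norm_apply_le_one x k
  · rw [hyn, Circle.norm_coe]
  · by_cases hk : k = n
    · subst hk
      exact (congrArg (fun w => ‖(x : EllInfty Γ) k - w‖) hyn).le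
    · change ‖(x : EllInfty Γ) k - y k‖ ≤ _
      rw [hyk k hk, sub_self, norm_zero]
      exact norm_nonneg _

end Coordinates

theorem Isometry.norm_sub_sphere {Γ X : Type*} [NormedAddCommGroup X]
    {Δ : UnitSphere (EllInfty Γ) → UnitSphere X} (hiso : Isometry Δ) (x y : UnitSphere (EllInfty Γ)) :
    ‖(Δ x : X) - Δ y‖ = dist x y := by
  rw [← dist_eq_norm, ← Subtype.dist_eq, hiso.dist_eq]

/-! ### Unimodular scalars of X acting on the images of the basis vectors. -/

section Sigma

variable {Γ X : Type*} [NormedAddCommGroup X] [NormedSpace ℂ X]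

theorem sigma_eq_id_or_conj (Δ : UnitSphere (EllInfty Γ) → UnitSphere X) (n : Γ) :
    (∀ α, sigma Δ n α = α) ∨ ∀ α, sigma Δ n α = conj α := by
  unfold sigma
  split_ifs
  · exact Or.inl fun _ => rfl
  · exact Or.inr fun _ => rfl

variable (Δ : UnitSphere (EllInfty Γ) → UnitSphere X) (n : Γ)

theorem sigma_sub (α β : ℂ) : sigma Δ n (α - β) = sigma Δ n α - sigma Δ n β := by
  rcases sigma_eq_id_or_conj Δ n with h | h <;> simp only [h, map_sub]

theorem sigma_neg (α : ℂ) : sigma Δ n (-α) = -sigma Δ n α := by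
  rcases sigma_eq_id_or_conj Δ n with h | h <;> simp only [h, map_neg]

theorem sigma_mul (α β : ℂ) : sigma Δ n (α * β) = sigma Δ n α * sigma Δ n β := by
  rcases sigma_eq_id_or_conj Δ n with h | h <;> simp only [h, map_mul]

theorem sigma_sum {ι : Type*} (s : Finset ι) (f : ι → ℂ) :
    sigma Δ n (∑ j ∈ s, f j) = ∑ j ∈ s, sigma Δ n (f j) := by
  rcases sigma_eq_id_or_conj Δ n with h | h <;> simp only [h, map_sum]

theorem sigma_sigma (α : ℂ) : sigma Δ n (sigma Δ n α) = α := by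
  rcases sigma_eq_id_or_conj Δ n with h | h <;> simp only [h, Complex.conj_conj]

/-- `sigma` restricted to the unit circle. -/
noncomputable def circleSigma (c : Circle) : Circle :=
  ⟨sigma Δ n c, mem_sphere_zero_iff_norm.2 ((norm_sigma Δ n c).trans (Circle.norm_coe c))⟩

theorem coe_circleSigma (c : Circle) : (circleSigma Δ n c : ℂ) = sigma Δ n c := rfl

theorem exists_circle_smul (hsurj : Function.Surjective Δ) (γ : Circle)
    (x : UnitSphere (EllInfty Γ)) :
    ∃ y, (Δ y : X) = (γ : ℂ) • (Δ x : X) := by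
  have hm : (γ : ℂ) • (Δ x : X) ∈ Metric.sphere (0 : X) 1 := by
    rw [mem_sphere_zero_iff_norm, norm_smul, Circle.norm_coe, one_mul]
    exact mem_sphere_zero_iff_norm.1 (Δ x).2
  obtain ⟨y, hy⟩ := hsurj ⟨_, hm⟩
  exact ⟨y, congrArg Subtype.val hy⟩

variable {Δ}

theorem norm_circle_smul_sub (γ : Circle) (u w : X) : ‖(γ : ℂ) • u - (γ : ℂ) • w‖ = ‖u - w‖ := by
  rw [← smul_sub, norm_smul, Circle.norm_coe, one_mul]

/-- Multiplication by γ, pulled back through Δ, is an isometry of the sphere, so it preserves the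
metric characterization; x' is the pullback of γ Δ(-e_n), as Δ(-e_n) = -Δ(e_n) is not yet available.
-/
theorem exists_circle_smul_basis (hiso : Isometry Δ) (hsurj : Function.Surjective Δ) (γ : Circle) :
    ∃ (m : Γ) (g : Circle), (Δ (circleBasisVec m g) : X) =
      (γ : ℂ) • (Δ (circleBasisVec n 1) : X) := by
  obtain ⟨x, hx⟩ := exists_circle_smul Δ hsurj γ (circleBasisVec n 1)
  obtain ⟨x', hx'⟩ := exists_circle_smul Δ hsurj γ (circleBasisVec n (-1))
  obtain ⟨m, g, rfl⟩ : ∃ (m : Γ) (g : Circle), x = circleBasisVec m g := by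
    apply exists_eq_circleBasisVec (x' := x')
    intro y hy
    obtain ⟨z, hz⟩ := exists_circle_smul Δ hsurj γ⁻¹ y
    have hyz : (Δ y : X) = (γ : ℂ) • (Δ z : X) := by
      rw [hz, smul_smul, ← Circle.coe_mul, mul_inv_cancel, Circle.coe_one, one_smul]
    rw [← hiso.norm_sub_sphere, hyz, hx', norm_circle_smul_sub, hiso.norm_sub_sphere,
      dist_circleBasisVec_eq_two_iff] at hy
    rw [← hiso.norm_sub_sphere, hyz, hx, norm_circle_smul_sub, hiso.norm_sub_sphere]
    exact dist_circleBasisVec_le_one (by simpa using hy)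
  exact ⟨m, g, hx⟩

theorem norm_circle_smul_sub_smul (γ δ : Circle) (u : UnitSphere X) :
    ‖(γ : ℂ) • (u : X) - (δ : ℂ) • (u : X)‖ = ‖(γ : ℂ) - δ‖ := by
  rw [← sub_smul, norm_smul, mem_sphere_zero_iff_norm.1 u.2, mul_one]

/-- Different indices are at distance 1. So -1 keeps the index, having distance 2 from 1; and a γ
that moved it would be at distance 1 from both 1 and -1, against the parallelogram law. -/
theorem exists_circle_smul_basis_self (hiso : Isometry Δ) (hsurj : Function.Surjective Δ)
    (γ : Circle) :
    ∃ g : Circle, (Δ (circleBasisVec n g) : X) = (γ : ℂ) • (Δ (circleBasisVec n 1) : X) := by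
  obtain ⟨m, g, hg⟩ := exists_circle_smul_basis n hiso hsurj γ
  obtain ⟨l, t, ht⟩ := exists_circle_smul_basis n hiso hsurj (-1)
  by_cases hm : m = n
  · exact ⟨g, hm ▸ hg⟩
  have key : ∀ δ : Circle, ‖(δ : ℂ) • (Δ (circleBasisVec n 1) : X) - Δ (circleBasisVec n 1)‖
      = ‖(δ : ℂ) - 1‖ := fun δ => by
    simpa using norm_circle_smul_sub_smul δ 1 (Δ (circleBasisVec n 1))
  have h1 := key γ
  rw [← hg, hiso.norm_sub_sphere, dist_circleBasisVec_of_ne hm] at h1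
  have hl : l = n := by
    by_contra hl
    have h2 := key (-1)
    rw [← ht, hiso.norm_sub_sphere, dist_circleBasisVec_of_ne hl] at h2
    norm_num at h2
  have h3 := norm_circle_smul_sub_smul γ (-1) (Δ (circleBasisVec n 1))
  rw [← hg, ← ht, hiso.norm_sub_sphere, hl, dist_circleBasisVec_of_ne hm] at h3
  have h4 := parallelogram_law_with_norm ℂ (γ : ℂ) 1
  rw [Circle.coe_neg, Circle.coe_one, sub_neg_eq_add] at h3
  rw [← h1, ← h3] at h4
  norm_num at h4

/-- The complex structure of `X` acts on the image of the basis vectors through `sigma`. -/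
theorem circle_smul_basis (hiso : Isometry Δ) (hsurj : Function.Surjective Δ) (γ : Circle) :
    (Δ (circleBasisVec n (circleSigma Δ n γ)) : X) =
      (γ : ℂ) • (Δ (circleBasisVec n 1) : X) := by
  have hnorm : ∀ γ δ g h : Circle,
      (Δ (circleBasisVec n g) : X) = (γ : ℂ) • (Δ (circleBasisVec n 1) : X) →
      (Δ (circleBasisVec n h) : X) = (δ : ℂ) • (Δ (circleBasisVec n 1) : X) →
      ‖(g : ℂ) - h‖ = ‖(γ : ℂ) - δ‖ := by
    intro γ δ g h hg hh
    rw [← dist_circleBasisVec_self n, ← hiso.norm_sub_sphere, hg, hh, norm_circle_smul_sub_smul]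
  have hsq : ∀ c : Circle, (c : ℂ).re ^ 2 + (c : ℂ).im ^ 2 = 1 := fun c => by
    have := Complex.sq_norm (c : ℂ)
    rw [Circle.norm_coe, Complex.normSq_apply] at this
    linarith
  -- On the unit circle distances determine real inner products.
  have hre : ∀ γ δ g h : Circle, ‖(g : ℂ) - h‖ = ‖(γ : ℂ) - δ‖ →
      (g : ℂ).re * (h : ℂ).re + (g : ℂ).im * (h : ℂ).im =
        (γ : ℂ).re * (δ : ℂ).re + (γ : ℂ).im * (δ : ℂ).im := by
    intro γ δ g h hgh
    have h1 := congrArg (· ^ 2) hgh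
    simp only [Complex.sq_norm, Complex.normSq_apply, Complex.sub_re, Complex.sub_im] at h1
    linarith [hsq γ, hsq δ, hsq g, hsq h]
  obtain ⟨g, hg⟩ := exists_circle_smul_basis_self n hiso hsurj γ
  have hone : (Δ (circleBasisVec n 1) : X) = ((1 : Circle) : ℂ) • (Δ (circleBasisVec n 1) : X) := by
    simp
  have h1 : (g : ℂ).re = (γ : ℂ).re := by simpa using hre _ _ _ _ (hnorm _ _ _ _ hg hone)
  have h2 : ((g : ℂ).im - (γ : ℂ).im) * ((g : ℂ).im + (γ : ℂ).im) = 0 := by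
    have h3 := hsq g
    rw [h1] at h3
    linarith [hsq γ]
  suffices circleSigma Δ n γ = g by rw [this, hg]
  apply Circle.ext
  rw [coe_circleSigma]
  unfold sigma
  -- Comparison with 1 leaves g = γ or its conjugate. A fixed non-real c forces equal imaginary
  -- parts; without one, a non-real γ with g = γ would itself be such a c.
  split_ifs with hc
  · obtain ⟨c, hc0, hc⟩ := hc
    have h3 := hre _ _ _ _ (hnorm _ _ _ _ hg hc)
    rw [h1] at h3
    exact Complex.ext h1.symm (mul_right_cancel₀ hc0 (by linarith))
  · push Not at hc
    refine Complex.ext (by simp [h1]) ?_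
    rw [Complex.conj_im]
    rcases mul_eq_zero.1 h2 with h3 | h3
    · by_cases h0 : (γ : ℂ).im = 0
      · linarith
      · exfalso
        have hgγ : g = γ := Circle.ext (Complex.ext h1 (by linarith))
        exact hc γ h0 (by rw [← hg, hgγ])
    · linarith

end Sigma

/-! ### Convex faces, support functionals and coordinates on X. -/

section SupportFunctional

variable {Γ X : Type*} [NormedAddCommGroup X] [NormedSpace ℂ X]

/-- Midpoints of u and z stay in K, so pairing one with w gives ‖u + z + 2w‖ = 4. Subtracting b z +
(2 - b) w, of norm at most 2, leaves ‖a z + b w + u‖ ≥ 2. -/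
theorem convex_of_two_eq_norm_add {K : Set X} {u : X} (hK : K ⊆ Metric.sphere 0 1)
    (hu : ∀ z, z ∈ K ↔ ‖z‖ = 1 ∧ ‖z + u‖ = 2) (hu1 : ‖u‖ = 1)
    (hpair : ∀ z ∈ K, ∀ w ∈ K, ‖z + w‖ = 2) : Convex ℝ K := by
  have hK1 : ∀ z ∈ K, ‖z‖ = 1 := fun z hz => mem_sphere_zero_iff_norm.1 (hK hz)
  have hns : ∀ (r : ℝ) (z : X), 0 ≤ r → ‖z‖ = 1 → ‖r • z‖ = r := fun r z hr hz => by
    rw [norm_smul, hz, mul_one, Real.norm_of_nonneg hr]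
  have hmid : ∀ z ∈ K, (1 / 2 : ℝ) • (u + z) ∈ K := by
    intro z hz
    have h2 : ‖u + z‖ = 2 := add_comm z u ▸ ((hu z).1 hz).2
    refine (hu _).2 ⟨?_, le_antisymm ?_ ?_⟩
    · rw [norm_smul, h2]; norm_num
    · refine (norm_add_le _ _).trans ?_
      rw [norm_smul, h2, hu1]; norm_num
    · have h3 : (1 / 2 : ℝ) • (u + z) + u = (3 / 2 : ℝ) • (u + z) - z := by module
      rw [h3]
      refine le_trans ?_ (norm_sub_norm_le _ _)
      rw [norm_smul, h2, hK1 z hz]; norm_num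
  intro z hz w hw a b ha hb hab
  have h1 : ‖(1 / 2 : ℝ) • (u + z) + w‖ = 2 := hpair _ (hmid z hz) _ hw
  have hupper : ‖a • z + b • w‖ ≤ 1 := by
    refine (norm_add_le _ _).trans ?_
    rw [hns a z ha (hK1 z hz), hns b w hb (hK1 w hw), hab]
  have hlower : 2 ≤ ‖a • z + b • w + u‖ := by
    have h3 : a • z + b • w + u =
        (2 : ℝ) • ((1 / 2 : ℝ) • (u + z) + w) - (b • z + (2 - b) • w) := by
      obtain rfl : a = 1 - b := by linarith
      module
    rw [h3]
    refine le_trans ?_ (norm_sub_norm_le _ _)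
    have h4 : ‖b • z + (2 - b) • w‖ ≤ 2 := by
      refine (norm_add_le _ _).trans ?_
      rw [hns b z hb (hK1 z hz), hns (2 - b) w (by linarith) (hK1 w hw)]
      linarith
    rw [norm_smul, h1]
    norm_num
    linarith
  have htri := norm_add_le (a • z + b • w) u
  exact (hu _).2 ⟨by linarith, by linarith⟩

/-- A convex subset of the unit sphere is contained in the support face of a functional. -/
theorem exists_functional_eq_one {K : Set X} (hconv : Convex ℝ K)
    (hK : K ⊆ Metric.sphere 0 1) :
    ∃ ψ : X →L[ℂ] ℂ, (∀ u, ‖ψ u‖ ≤ ‖u‖) ∧ ∀ u ∈ K, ψ u = 1 := by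
  have hdisj : Disjoint (Metric.ball (0 : X) 1) K :=
    Set.disjoint_left.2 fun u hu hu' => by
      have h1 := mem_ball_zero_iff.1 hu
      have h2 := mem_sphere_zero_iff_norm.1 (hK hu')
      linarith
  obtain ⟨f, s, hf, hfK⟩ := RCLike.geometric_hahn_banach_open (𝕜 := ℂ) (convex_ball (0 : X) 1)
    Metric.isOpen_ball hconv hdisj
  have hs : 0 < s := by simpa using hf 0 (by simp)
  have hbound : ∀ u, ‖f u‖ ≤ s * ‖u‖ := by
    intro u
    by_contra! hlt
    obtain ⟨c, hc, hcu⟩ := Complex.exists_norm_eq_mul_self (f u)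
    have ht : 0 < ‖f u‖ := (mul_nonneg hs.le (norm_nonneg u)).trans_lt hlt
    have ht' : (‖f u‖ : ℂ) ≠ 0 := by exact_mod_cast ht.ne'
    -- Rotated and rescaled, u would be a point of the open ball where f takes the value s, against
    -- the separation.
    have hmem : (((s / ‖f u‖ : ℝ) : ℂ) * c) • u ∈ Metric.ball (0 : X) 1 := by
      rw [mem_ball_zero_iff, norm_smul, norm_mul, hc, mul_one, Complex.norm_real,
        Real.norm_of_nonneg (by positivity), div_mul_eq_mul_div, div_lt_one ht]
      exact hlt
    have hfs : f ((((s / ‖f u‖ : ℝ) : ℂ) * c) • u) = s := by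
      rw [map_smul, smul_eq_mul, mul_assoc, ← hcu, Complex.ofReal_div, div_mul_cancel₀ _ ht']
    have := hf _ hmem
    rw [hfs] at this
    exact lt_irrefl _ this
  have hnorm : ∀ u, ‖((s : ℂ)⁻¹ • f) u‖ ≤ ‖u‖ := fun u => by
    rw [smul_apply, norm_smul, norm_inv, Complex.norm_real,
      Real.norm_of_nonneg hs.le, inv_mul_le_iff₀ hs]
    exact hbound u
  refine ⟨(s : ℂ)⁻¹ • f, hnorm, fun u hu => ?_⟩
  have h1 : 1 ≤ (((s : ℂ)⁻¹ • f) u).re := by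
    rw [smul_apply, smul_eq_mul, ← Complex.ofReal_inv, Complex.re_ofReal_mul,
      le_inv_mul_iff₀ hs, mul_one]
    exact hfK u hu
  have h2 := hnorm u
  rw [mem_sphere_zero_iff_norm.1 (hK hu)] at h2
  have h3 := Complex.sq_norm (((s : ℂ)⁻¹ • f) u)
  rw [Complex.normSq_apply] at h3
  refine Complex.ext ?_ ?_
  · exact le_antisymm ((Complex.re_le_norm _).trans h2) h1
  · rw [Complex.one_im]
    nlinarith [norm_nonneg (((s : ℂ)⁻¹ • f) u)]

variable {Δ : UnitSphere (EllInfty Γ) → UnitSphere X} (n : Γ)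

theorem map_neg_one_basis (hiso : Isometry Δ) (hsurj : Function.Surjective Δ) :
    (Δ (circleBasisVec n (-1)) : X) = -Δ (circleBasisVec n 1) := by
  have h := circle_smul_basis n hiso hsurj (-1)
  have h1 : circleSigma Δ n (-1) = -1 := Circle.ext (by
    rw [coe_circleSigma]
    rcases sigma_eq_id_or_conj Δ n with h | h <;> simp [h])
  simpa [h1] using h

/-- The image under `Δ` of the face of points with `n`-th coordinate one. -/
def imageFace (Δ : UnitSphere (EllInfty Γ) → UnitSphere X) (n : Γ) : Set X :=
  {z | ∃ x : UnitSphere (EllInfty Γ), (x : EllInfty Γ) n = 1 ∧ (Δ x : X) = z}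

theorem norm_add_basis_eq_two_iff (hiso : Isometry Δ) (hsurj : Function.Surjective Δ)
    (x : UnitSphere (EllInfty Γ)) :
    ‖(Δ x : X) + Δ (circleBasisVec n 1)‖ = 2 ↔ (x : EllInfty Γ) n = 1 := by
  rw [← sub_neg_eq_add, ← map_neg_one_basis n hiso hsurj, hiso.norm_sub_sphere,
    dist_circleBasisVec_eq_two_iff]
  simp

theorem convex_imageFace (hiso : Isometry Δ) (hsurj : Function.Surjective Δ) :
    Convex ℝ (imageFace Δ n) := by
  refine convex_of_two_eq_norm_add (u := Δ (circleBasisVec n 1)) ?_ ?_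
    (mem_sphere_zero_iff_norm.1 (Δ _).2) ?_
  · rintro _ ⟨x, -, rfl⟩
    exact (Δ x).2
  · intro z
    constructor
    · rintro ⟨x, hx, rfl⟩
      exact ⟨mem_sphere_zero_iff_norm.1 (Δ x).2, (norm_add_basis_eq_two_iff n hiso hsurj x).2 hx⟩
    · rintro ⟨hz, hz2⟩
      obtain ⟨x, hx⟩ := hsurj ⟨z, mem_sphere_zero_iff_norm.2 hz⟩
      obtain rfl : (Δ x : X) = z := congrArg Subtype.val hx
      exact ⟨x, (norm_add_basis_eq_two_iff n hiso hsurj x).1 hz2, rfl⟩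
  · rintro _ ⟨x, hx, rfl⟩ _ ⟨y, hy, rfl⟩
    -- The preimage w of -Δ y has n-th coordinate -1, so it lies at distance 2 from x; w = -y is not
    -- needed.
    obtain ⟨w, hw⟩ := exists_circle_smul Δ hsurj (-1) y
    have hw' : (Δ w : X) = -Δ y := by simpa using hw
    have hwn : (w : EllInfty Γ) n = -1 := by
      have h1 := (norm_add_basis_eq_two_iff n hiso hsurj y).2 hy
      rw [← norm_neg, neg_add', ← hw', hiso.norm_sub_sphere, dist_circleBasisVec_eq_two_iff] at h1
      simpa using h1
    rw [← sub_neg_eq_add, ← hw', hiso.norm_sub_sphere]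
    apply le_antisymm
    · exact EllInfty.dist_le zero_le_two fun k => (norm_sub_le _ _).trans
        (by linarith [EllInfty.norm_apply_le_one x k, EllInfty.norm_apply_le_one w k])
    · have h2 := EllInfty.dist_apply_le x w n
      rw [hx, hwn] at h2
      norm_num at h2
      exact h2

/-- Write z = r c with r = ‖z‖. The closed discs of radius 1 - r about c and 1 + r about -c are
tangent at z, so these two points of the circle suffice. -/
theorem Complex.eq_of_norm_sub_circle_le {w z : ℂ} (hz : ‖z‖ ≤ 1)
    (h : ∀ c : Circle, ‖w - c‖ ≤ ‖z - c‖) : w = z := by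
  obtain ⟨c, hc⟩ : ∃ c : Circle, z = ‖z‖ * c := by
    by_cases h0 : z = 0
    · exact ⟨1, by simp [h0]⟩
    · have h0' : ‖z‖ ≠ 0 := norm_ne_zero_iff.2 h0
      refine ⟨⟨z / ‖z‖, mem_sphere_zero_iff_norm.2 ?_⟩, ?_⟩
      · rw [norm_div, Complex.norm_real, norm_norm, div_self h0']
      · exact (mul_div_cancel₀ z (by exact_mod_cast h0')).symm
  set r := ‖z‖ with hr
  have hr0 : 0 ≤ r := norm_nonneg z
  have hnorm : ∀ a : ℂ, ‖a * c‖ = ‖a‖ := fun a => by rw [norm_mul, Circle.norm_coe, mul_one]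
  obtain ⟨a, rfl⟩ : ∃ a : ℂ, w = a * c :=
    ⟨w / c, (div_mul_cancel₀ w (Circle.coe_ne_zero c)).symm⟩
  have h1 : ‖a - 1‖ ≤ 1 - r := by
    have h2 := h c
    rw [hc, ← sub_one_mul, ← sub_one_mul, hnorm, hnorm, ← Complex.ofReal_one,
      ← Complex.ofReal_sub, Complex.norm_real, Real.norm_of_nonpos (by linarith)] at h2
    simpa using h2
  have h2 : ‖a + 1‖ ≤ 1 + r := by
    have h2 := h (-c)
    rw [hc, Circle.coe_neg, sub_neg_eq_add, sub_neg_eq_add, ← add_one_mul, ← add_one_mul, hnorm,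
      hnorm, ← Complex.ofReal_one, ← Complex.ofReal_add, Complex.norm_real,
      Real.norm_of_nonneg (by linarith)] at h2
    simpa [add_comm] using h2
  have h3 : (a.re - 1) ^ 2 + a.im ^ 2 ≤ (1 - r) ^ 2 := by
    have := pow_le_pow_left₀ (norm_nonneg _) h1 2
    rw [Complex.sq_norm, Complex.normSq_apply] at this
    simp at this
    linarith
  have h4 : a.re = r := by
    have h5 := (Complex.re_le_norm (a + 1)).trans h2
    have h6 := (Complex.abs_re_le_norm (a - 1)).trans h1
    simp at h5 h6
    linarith [neg_abs_le (a.re - 1)]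
  have h5 : a.im = 0 := by
    rw [h4] at h3
    have : a.im ^ 2 ≤ 0 := by linarith
    exact pow_eq_zero_iff two_ne_zero |>.1 (le_antisymm this (sq_nonneg _))
  rw [hc, show a = r from Complex.ext h4 h5]

/-- For every `n` there is a contractive complex functional on `X` which reads off the `n`-th
coordinate, up to `sigma`, of the preimage under `Δ`. -/
theorem exists_coordinate_functional (hiso : Isometry Δ) (hsurj : Function.Surjective Δ) :
    ∃ ψ : X →L[ℂ] ℂ, (∀ u, ‖ψ u‖ ≤ ‖u‖) ∧
      ∀ x : UnitSphere (EllInfty Γ), ψ (Δ x) = sigma Δ n ((x : EllInfty Γ) n) := by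
  obtain ⟨ψ, hψ, hψ1⟩ := exists_functional_eq_one (convex_imageFace n hiso hsurj)
    (by rintro _ ⟨x, -, rfl⟩; exact (Δ x).2)
  refine ⟨ψ, hψ, ?_⟩
  have hface : ∀ (γ : Circle) (x : UnitSphere (EllInfty Γ)),
      (x : EllInfty Γ) n = circleSigma Δ n γ → ψ (Δ x) = γ := by
    intro γ x hx
    -- Rotation back by γ lands in the face y(n) = 1, where ψ is 1.
    obtain ⟨y, hy⟩ := exists_circle_smul Δ hsurj γ⁻¹ x
    have hxy : (Δ x : X) = (γ : ℂ) • (Δ y : X) := by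
      rw [hy, smul_smul, ← Circle.coe_mul, mul_inv_cancel, Circle.coe_one, one_smul]
    have h1 : (Δ (circleBasisVec n (-circleSigma Δ n γ)) : X) =
        (γ : ℂ) • (Δ (circleBasisVec n (-1)) : X) := by
      have h2 := circle_smul_basis n hiso hsurj (-γ)
      have h3 : circleSigma Δ n (-γ) = -circleSigma Δ n γ := Circle.ext (by
        rw [coe_circleSigma, Circle.coe_neg, Circle.coe_neg, sigma_neg, coe_circleSigma])
      rw [← h3, h2, map_neg_one_basis n hiso hsurj, Circle.coe_neg, neg_smul, smul_neg]
    have h4 : dist x (circleBasisVec n (-circleSigma Δ n γ)) = 2 :=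
      (dist_circleBasisVec_eq_two_iff _ _ _).2 (by simp [hx])
    rw [← hiso.norm_sub_sphere, h1, hxy, norm_circle_smul_sub, hiso.norm_sub_sphere,
      dist_circleBasisVec_eq_two_iff] at h4
    rw [hxy, map_smul, hψ1 _ ⟨y, by simpa using h4, rfl⟩, smul_eq_mul, mul_one]
  intro x
  apply Complex.eq_of_norm_sub_circle_le
  · rw [norm_sigma]
    exact EllInfty.norm_apply_le_one x n
  · intro c
    -- The nearby y has ψ(Δ y) = c, so contractivity of ψ bounds the distance from ψ(Δ x) to c.
    obtain ⟨y, hy, hxy⟩ := EllInfty.exists_sphere_apply_eq x n (circleSigma Δ n c)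
    rw [← hface c y hy, ← map_sub]
    refine (hψ _).trans ?_
    rw [hiso.norm_sub_sphere, hface c y hy]
    refine hxy.trans_eq ?_
    rw [← norm_sigma Δ n, sigma_sub, coe_circleSigma, sigma_sigma]

/-- The coordinate functionals determine the norm of `X`. -/
theorem norm_le_of_coordinate_functionals (hsurj : Function.Surjective Δ)
    {ψ : Γ → X →L[ℂ] ℂ}
    (hψ : ∀ n (x : UnitSphere (EllInfty Γ)), ψ n (Δ x) = sigma Δ n ((x : EllInfty Γ) n))
    {u : X} {r : ℝ} (hr : 0 ≤ r) (h : ∀ n, ‖ψ n u‖ ≤ r) : ‖u‖ ≤ r := by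
  by_cases hu : u = 0
  · simpa [hu] using hr
  have hu0 : 0 < ‖u‖ := norm_pos_iff.2 hu
  -- Normalised, u is Δ x with ‖x‖ = 1, and the functionals bound each coordinate of x by r / ‖u‖.
  obtain ⟨x, hx⟩ := hsurj ⟨((‖u‖⁻¹ : ℝ) : ℂ) • u, mem_sphere_zero_iff_norm.2 (by
    rw [norm_smul, Complex.norm_real, norm_inv, norm_norm, inv_mul_cancel₀ hu0.ne'])⟩
  have hx1 : (Δ x : X) = ((‖u‖⁻¹ : ℝ) : ℂ) • u := congrArg Subtype.val hx
  have h1 : ‖(x : EllInfty Γ)‖ ≤ ‖u‖⁻¹ * r := by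
    refine lp.norm_le_of_forall_le (by positivity) fun n => ?_
    rw [← norm_sigma Δ n, ← hψ, hx1, map_smul, norm_smul, Complex.norm_real, norm_inv, norm_norm]
    exact mul_le_mul_of_nonneg_left (h n) (by positivity)
  rwa [mem_sphere_zero_iff_norm.1 x.2, le_inv_mul_iff₀ hu0, mul_one] at h1

end SupportFunctional

/-! ### Pointwise sums over orthogonal partial isometries. -/

section OrthogonalFamilies

variable {Γ : Type*}

theorem IsPartialIsometry.norm_apply_eq {v : EllInfty Γ} (hv : IsPartialIsometry v) (n : Γ) :
    ‖v n‖ = 0 ∨ ‖v n‖ = 1 :=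
  (mul_eq_zero.1 ((isPartialIsometry_iff v).1 hv n)).imp_right fun h => by linarith

theorem IsPartialIsometry.exists_norm_apply_eq_one {v : EllInfty Γ} (hv : IsPartialIsometry v)
    (h0 : v ≠ 0) : ∃ n, ‖v n‖ = 1 := by
  by_contra! h
  exact h0 (EllInfty.ext fun n => norm_eq_zero.1 ((hv.norm_apply_eq n).resolve_right (h n)))

theorem apply_eq_zero_of_orthogonal {ι : Type*} {v : ι → EllInfty Γ}
    (horth : Pairwise fun i j => v i * v j = 0) {i j : ι} (hij : j ≠ i) {n : Γ} (hi : v i n ≠ 0) :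
    v j n = 0 := by
  have h : v i n * v j n = 0 := congrArg (fun f : EllInfty Γ => f n) (horth hij.symm)
  exact (mul_eq_zero.1 h).resolve_left hi

/-- At each coordinate at most one member of an orthogonal family contributes to the sum. -/
theorem sum_eq_of_orthogonal {ι : Type*} [Fintype ι] {v : ι → EllInfty Γ}
    (horth : Pairwise fun i j => v i * v j = 0) {i : ι} {n : Γ} (hi : v i n ≠ 0) {f : ι → ℂ}
    (hf : ∀ j, v j n = 0 → f j = 0) : ∑ j, f j = f i :=
  Finset.sum_eq_single i (fun _ _ hj => hf _ (apply_eq_zero_of_orthogonal horth hj hi))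
    (fun h => absurd (Finset.mem_univ i) h)

theorem norm_sum_eq_of_orthogonal {ι : Type*} [Fintype ι] {v : ι → EllInfty Γ}
    (hpi : ∀ j, IsPartialIsometry (v j))
    (horth : Pairwise fun i j => v i * v j = 0) (n : Γ) {α : ι → ℂ} {f : ι → ℂ}
    (hf : ∀ j, ‖f j‖ = ‖α j‖ * ‖v j n‖) :
    ‖∑ j, f j‖ = 0 ∨ ∃ j, ‖∑ j, f j‖ = ‖α j‖ := by
  have hf0 : ∀ j, v j n = 0 → f j = 0 := fun j hj => norm_eq_zero.1 (by simp [hf, hj])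
  by_cases h : ∃ i, v i n ≠ 0
  · obtain ⟨i, hi⟩ := h
    refine Or.inr ⟨i, ?_⟩
    rw [sum_eq_of_orthogonal horth hi hf0, hf,
      ((hpi i).norm_apply_eq n).resolve_left (norm_ne_zero_iff.2 hi), mul_one]
  · push Not at h
    left
    rw [Finset.sum_eq_zero fun j _ => hf0 j (h j), norm_zero]

end OrthogonalFamilies

theorem EllInfty.sum_apply {Γ ι : Type*} (s : Finset ι) (f : ι → EllInfty Γ) (n : Γ) :
    (∑ j ∈ s, f j) n = ∑ j ∈ s, f j n := by
  rw [lp.coeFn_sum, Finset.sum_apply]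

/-! ### The theorem, read off through the coordinate functionals. -/

theorem proposition2p6 {Γ X : Type*} [Infinite Γ]
    [NormedAddCommGroup X] [NormedSpace ℂ X] [CompleteSpace X]
    (Δ : UnitSphere (EllInfty Γ) → UnitSphere X)
    (hiso : Isometry Δ) (hsurj : Function.Surjective Δ)
    {k : ℕ} (hk : 1 ≤ k) (v : Fin k → EllInfty Γ)
    (hpi : ∀ j, IsPartialIsometry (v j)) (hne : ∀ j, v j ≠ 0)
    (horth : Pairwise fun i j => v i * v j = 0) :
    CompletelyMOrthogonal (fun j => (Δ ⟨v j, (hpi j).mem_sphere (hne j)⟩ : X)) ∧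
    ∀ α : Fin k → ℂ, (∀ j, α j ≠ 0) → IsGreatest (Set.range fun j => ‖α j‖) 1 →
      ∃ hmem : ∑ j, twistedSMul Δ (α j) (v j) ∈ Metric.sphere (0 : EllInfty Γ) 1,
        ∑ j, α j • (Δ ⟨v j, (hpi j).mem_sphere (hne j)⟩ : X) =
          (Δ ⟨∑ j, twistedSMul Δ (α j) (v j), hmem⟩ : X) := by
  choose ψ hψ hψΔ using fun n => exists_coordinate_functional n hiso hsurj
  set w : Fin k → X := fun j => (Δ ⟨v j, (hpi j).mem_sphere (hne j)⟩ : X) with hw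
  have hw1 : ∀ j, ‖w j‖ = 1 := fun j => mem_sphere_zero_iff_norm.1 (Δ _).2
  have hψw : ∀ n j, ψ n (w j) = sigma Δ n (v j n) := fun n j => hψΔ n _
  have hψsum : ∀ n (α : Fin k → ℂ), ψ n (∑ j, α j • w j) = ∑ j, α j * sigma Δ n (v j n) := by
    intro n α
    simp only [map_sum, map_smul, smul_eq_mul, hψw]
  refine ⟨fun α => ?_, fun α hα hmax => ?_⟩
  · have hsm : ∀ j, ‖α j • w j‖ = ‖α j‖ := fun j => by rw [norm_smul, hw1, mul_one]
    have hupper : ∀ j, ‖α j‖ ≤ ‖∑ i, α i • w i‖ := by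
      intro j
      -- At a coordinate in the support of v_j, the functional ψ_n sees only the j-th term.
      obtain ⟨n, hn⟩ := (hpi j).exists_norm_apply_eq_one (hne j)
      have hn0 : v j n ≠ 0 := norm_ne_zero_iff.1 (by simp [hn])
      have h1 := hψ n (∑ i, α i • w i)
      rwa [hψsum, sum_eq_of_orthogonal horth hn0 (fun i hi => norm_eq_zero.1 (by
        rw [norm_mul, norm_sigma, hi, norm_zero, mul_zero])), norm_mul, norm_sigma, hn,
        mul_one] at h1
    have : Nonempty (Fin k) := ⟨⟨0, hk⟩⟩
    obtain ⟨i, hi⟩ := Finite.exists_max fun j => ‖α j‖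
    have hlower : ‖∑ j, α j • w j‖ ≤ ‖α i‖ := by
      refine norm_le_of_coordinate_functionals hsurj hψΔ (norm_nonneg _) fun n => ?_
      rw [hψsum]
      rcases norm_sum_eq_of_orthogonal hpi horth n (α := α)
        (f := fun j => α j * sigma Δ n (v j n))
        (fun j => by rw [norm_mul, norm_sigma]) with h | ⟨j, h⟩
      · exact h.le.trans (norm_nonneg _)
      · exact h.le.trans (hi j)
    refine ⟨⟨i, (hsm i).trans (le_antisymm (hupper i) hlower)⟩, ?_⟩
    rintro _ ⟨j, rfl⟩
    exact (hsm j).le.trans (hupper j)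
  · have happ : ∀ n, (∑ j, twistedSMul Δ (α j) (v j)) n = ∑ j, sigma Δ n (α j) * v j n :=
      fun n => EllInfty.sum_apply _ _ n
    have hmem : ∑ j, twistedSMul Δ (α j) (v j) ∈ Metric.sphere (0 : EllInfty Γ) 1 := by
      obtain ⟨⟨i, hi⟩, hle⟩ := hmax
      obtain ⟨n, hn⟩ := (hpi i).exists_norm_apply_eq_one (hne i)
      have hn0 : v i n ≠ 0 := norm_ne_zero_iff.1 (by simp [hn])
      refine mem_sphere_zero_iff_norm.2 (EllInfty.norm_eq_one (n := n) (fun m => ?_) ?_)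
      · rw [happ]
        rcases norm_sum_eq_of_orthogonal hpi horth m (α := α)
          (f := fun j => sigma Δ m (α j) * v j m)
          (fun j => by rw [norm_mul, norm_sigma]) with h | ⟨j, h⟩
        · exact h.le.trans zero_le_one
        · exact h.le.trans (hle ⟨j, rfl⟩)
      · rw [happ, sum_eq_of_orthogonal horth hn0 (fun j hj => by rw [hj, mul_zero]), norm_mul,
          norm_sigma, hn, mul_one]
        exact hi
    -- The difference of the two sides is killed by every ψ_n, hence has norm zero.
    refine ⟨hmem, sub_eq_zero.1 (norm_le_zero_iff.1
      (norm_le_of_coordinate_functionals hsurj hψΔ le_rfl fun n => ?_))⟩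
    rw [map_sub, hψsum, hψΔ, happ, sigma_sum]
    simp only [sigma_mul, sigma_sigma, sub_self, norm_zero, le_refl]
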